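/- Let $D$ be a division algebra which is finite-dimensional over its centre $Z$, let $Z[X]=Z[u_1,\dots,u_q]$ be a polynomial ring in finitely many variables, $Z(X)=\mathrm{Frac}\,Z[X]$, and let $D(X)$ be the division ring of rational functions in these variables over $D$, that is, the skew field of fractions of $D[X]=D\otimes_Z Z[X]$; its centre is $Z(X)$. For a central simple algebra $R$ over a field $F$, let $\mathrm{Exp}\,R$ be the order of $R$ in the Brauer group of $F$, i.e. the smallest $n\ge 1$ such that the $n$-th tensor power $R^{\otimes n}$ over $F$ is isomorphic to a matrix algebra $M_N(F)$. A maximal subfield of a division ring is a subfield which is equal to its own centralizer. Then: (1) $[D(X):Z(X)]=[D:Z]$ and $\mathrm{Exp}\,D(X)=\mathrm{Exp}\,D$. (2) $D(X)$ has a maximal subfield which is Galois over $Z(X)$ if and only if $D$ has a maximal subfield which is Galois over $Z$. (3) Suppose $\mathrm{char}(Z)=p>0$, and let $r\ge 0$ be an integer. Then $D(X)$ has a maximal subfield which is purely inseparable of exponent $r$ over $Z(X)$ if and only if $D$ has a maximal subfield which is purely inseparable of exponent $r$ over $Z$. Likewise, $D(X)$ has a maximal subfield which is Galois over $Z(X)$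 with Galois group isomorphic to $\mathbb{Z}_p^r$ if and only if $D$ has a maximal subfield which is Galois over $Z$ with Galois group isomorphic to $\mathbb{Z}_p^r$, where $\mathbb{Z}_p$ denotes the cyclic group of order $p$. (Purely inseparable of exponent $r$ over a field $F$ of characteristic $p$ means that $r$ is the smallest integer $\ge 0$ such that $a^{p^r}\in F$ for all elements $a$ of the extension.) -/

import Mathlib

open scoped TensorProduct nonZeroDivisors

namespace SkewRational

noncomputable section

/-- The polynomial ring `D[X] = D ⊗_Z Z[u₁, …, u_q]` over a `Z`-algebra `D`. -/
abbrev SkewPoly (Z D : Type*) [Field Z] [DivisionRing D] [Algebra Z D] (q : ℕ) : Type _ :=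
  D ⊗[Z] MvPolynomial (Fin q) Z

section Construction

variable (Z D : Type*) [Field Z] [DivisionRing D] [Algebra Z D] (q : ℕ)

instance instNoZeroDivisorsSkewPoly : NoZeroDivisors (SkewPoly Z D q) := by
  let ι : D →ₐ[Z] AddMonoidAlgebra D (Fin q →₀ ℕ) :=
    AlgHom.mk AddMonoidAlgebra.singleZeroRingHom (fun _ => rfl)
  let κ : MvPolynomial (Fin q) Z →ₐ[Z] AddMonoidAlgebra D (Fin q →₀ ℕ) :=
    AddMonoidAlgebra.mapAlgHom _ (Algebra.ofId Z D)
  have hκ : ∀ (u : Fin q →₀ ℕ) (c : Z),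
      κ (MvPolynomial.monomial u c) = AddMonoidAlgebra.single u (algebraMap Z D c) := by
    intro u c
    simp [κ, ← MvPolynomial.single_eq_monomial, Algebra.ofId_apply]
  have hι : ∀ a, ι a = AddMonoidAlgebra.single 0 a := fun _ => rfl
  let φ : SkewPoly Z D q →ₐ[Z] AddMonoidAlgebra D (Fin q →₀ ℕ) :=
    Algebra.TensorProduct.lift ι κ (fun a f => by
        induction f using MvPolynomial.induction_on' with
        | monomial u c =>
          rw [hκ, hι, commute_iff_eq, AddMonoidAlgebra.single_mul_single,
            AddMonoidAlgebra.single_mul_single, add_comm, Algebra.commutes c a]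
        | add f g hf hg => rw [map_add]; exact hf.add_right hg)
  have key : ∀ x, (φ x).coeff =
      (Algebra.TensorProduct.basis D (MvPolynomial.basisMonomials (Fin q) Z)).repr x := by
    intro x
    induction x using TensorProduct.induction_on with
    | zero => simp
    | add x y hx hy => simp [hx, hy]
    | tmul a f =>
      induction f using MvPolynomial.induction_on' with
      | monomial u c =>
        ext m
        have h1 : (MvPolynomial.basisMonomials (Fin q) Z).repr (MvPolynomial.monomial u c) =
            Finsupp.single u c := rfl
        simp [φ, hκ, hι, h1, Finsupp.single_apply]
      | add f g hf hg => rw [TensorProduct.tmul_add, map_add, map_add, ← hf, ← hg]; rfl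
  have hφ : Function.Injective φ := by
    intro x y hxy
    apply (Algebra.TensorProduct.basis D (MvPolynomial.basisMonomials (Fin q) Z)).repr.injective
    rw [← key, ← key, hxy]
  exact hφ.noZeroDivisors φ (map_zero φ) (map_mul φ)

theorem includeRight_injective :
    Function.Injective
      (Algebra.TensorProduct.includeRight : MvPolynomial (Fin q) Z →ₐ[Z] SkewPoly Z D q) :=
  Algebra.TensorProduct.includeRight_injective (algebraMap Z D).injective

theorem includeRight_commute (f : MvPolynomial (Fin q) Z) (x : SkewPoly Z D q) :
    Commute (Algebra.TensorProduct.includeRight f : SkewPoly Z D q) x := by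
  induction x using TensorProduct.induction_on with
  | zero => exact Commute.zero_right _
  | tmul a g => simp [Commute, SemiconjBy, mul_comm]
  | add x y hx hy => exact hx.add_right hy

/-- If `D` is finite-dimensional over `Z`, every nonzero element of `D[X]` has a nonzero left
multiple in `Z[X]`. -/
theorem exists_mul_eq_includeRight [FiniteDimensional Z D] (s : SkewPoly Z D q) (hs : s ≠ 0) :
    ∃ (t : SkewPoly Z D q) (f : MvPolynomial (Fin q) Z), f ≠ 0 ∧
      t * s = Algebra.TensorProduct.includeRight f := by
  let _ : Algebra (MvPolynomial (Fin q) Z) (SkewPoly Z D q) := Algebra.TensorProduct.rightAlgebra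
  have _ : Module.Finite (MvPolynomial (Fin q) Z) (SkewPoly Z D q) :=
    Module.Finite.equiv (Algebra.TensorProduct.commRight Z (MvPolynomial (Fin q) Z) D).toLinearEquiv
  have key : ∀ (n : ℕ) (p : Polynomial (MvPolynomial (Fin q) Z)), p.natDegree ≤ n → p ≠ 0 →
      Polynomial.aeval s p = 0 → ∃ (t : SkewPoly Z D q) (f : MvPolynomial (Fin q) Z), f ≠ 0 ∧
        t * s = algebraMap _ _ f := by
    intro n
    induction n with
    | zero =>
      intro p hn hp h
      exfalso
      rw [Polynomial.eq_C_of_natDegree_le_zero hn] at h hp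
      rw [Polynomial.aeval_C] at h
      exact hp (by rw [includeRight_injective Z D q (h.trans (map_zero _).symm), map_zero])
    | succ n ih =>
      intro p hn hp h
      have hdec := Polynomial.divX_mul_X_add p
      have h' := h
      rw [← hdec] at h'
      simp only [map_add, map_mul, Polynomial.aeval_X, Polynomial.aeval_C] at h'
      by_cases h0 : p.coeff 0 = 0
      · rw [h0, map_zero, add_zero] at h'
        refine ih p.divX (by rw [Polynomial.natDegree_divX_eq_natDegree_tsub_one]; omega) ?_
          ((mul_eq_zero.mp h').resolve_right hs)
        intro h1
        apply hp
        rw [← hdec, h1, h0]; simp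
      · refine ⟨Polynomial.aeval s p.divX, -p.coeff 0, neg_ne_zero.mpr h0, ?_⟩
        rw [map_neg]
        exact eq_neg_of_add_eq_zero_left h'
  obtain ⟨p, hp, h⟩ := (IsIntegral.of_finite (MvPolynomial (Fin q) Z) s)
  exact key _ p le_rfl hp.ne_zero h

variable [FiniteDimensional Z D]

/-- The nonzero elements of `D[X]` form an Ore set. -/
instance instOreSetSkewPoly : OreLocalization.OreSet (SkewPoly Z D q)⁰ := by
  have h : ∀ (r : SkewPoly Z D q) (s : (SkewPoly Z D q)⁰),
      ∃ (r' : SkewPoly Z D q) (s' : (SkewPoly Z D q)⁰), (s' : SkewPoly Z D q) * r = r' * s := by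
    intro r s
    obtain ⟨t, f, hf, h⟩ := exists_mul_eq_includeRight Z D q s (nonZeroDivisors.ne_zero s.2)
    refine ⟨r * t, ⟨Algebra.TensorProduct.includeRight f, mem_nonZeroDivisors_of_ne_zero
      ((map_ne_zero_iff _ (includeRight_injective Z D q)).mpr hf)⟩, ?_⟩
    rw [mul_assoc, h]
    exact includeRight_commute Z D q f r
  choose r' s' h using h
  exact OreLocalization.oreSetOfNoZeroDivisors r' s' h

/-- The division ring `D(X)` of rational functions in `q` variables over `D`: the skew field of
fractions of `D[X]`. -/
def SkewRatFunc : Type _ := OreLocalization (SkewPoly Z D q)⁰ (SkewPoly Z D q)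

instance instDivisionRingSkewRatFunc : DivisionRing (SkewRatFunc Z D q) :=
  inferInstanceAs (DivisionRing (OreLocalization (SkewPoly Z D q)⁰ (SkewPoly Z D q)))

/-- The inclusion `D[X] → D(X)`. -/
def ofPoly : SkewPoly Z D q →+* SkewRatFunc Z D q :=
  OreLocalization.numeratorRingHom (S := (SkewPoly Z D q)⁰)

theorem ofPoly_injective : Function.Injective (ofPoly Z D q) :=
  OreLocalization.numeratorHom_inj (fun _ hx => hx.1)

/-- Every element of `D(X)` is a fraction of elements of `D[X]`. -/
theorem exists_fraction (x : SkewRatFunc Z D q) :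
    ∃ (a s : SkewPoly Z D q), s ≠ 0 ∧ ofPoly Z D q s * x = ofPoly Z D q a := by
  induction x using OreLocalization.ind with
  | _ a s =>
    exact ⟨a, s, nonZeroDivisors.ne_zero s.2, OreLocalization.mul_cancel⟩

/-- The field `Z(X) = Frac Z[u₁, …, u_q]`. -/
abbrev RatFuncField (Z : Type*) [Field Z] (q : ℕ) : Type _ :=
  FractionRing (MvPolynomial (Fin q) Z)

/-- Elements of `Z[X]` are central in `D(X)`. -/
theorem ofPoly_includeRight_mem_center (f : MvPolynomial (Fin q) Z) :
    ofPoly Z D q (Algebra.TensorProduct.includeRight f) ∈ Subring.center (SkewRatFunc Z D q) := by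
  rw [Subring.mem_center_iff]
  intro x
  obtain ⟨a, s, hs, h⟩ := exists_fraction Z D q x
  have hs' : ofPoly Z D q s ≠ 0 := (map_ne_zero_iff _ (ofPoly_injective Z D q)).mpr hs
  have c : ∀ y, ofPoly Z D q (Algebra.TensorProduct.includeRight f) * ofPoly Z D q y =
      ofPoly Z D q y * ofPoly Z D q (Algebra.TensorProduct.includeRight f) := fun y => by
    rw [← map_mul, ← map_mul, (includeRight_commute Z D q f y).eq]
  apply mul_left_cancel₀ hs'
  rw [← mul_assoc, h, ← mul_assoc, ← c s, mul_assoc, h, c a]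

/-- The inclusion `Z[X] → D[X] → D(X)`, with values in the centre of `D(X)`. -/
def polyToCenter : MvPolynomial (Fin q) Z →+* Subring.center (SkewRatFunc Z D q) :=
  RingHom.codRestrict
    ((ofPoly Z D q).comp
      (Algebra.TensorProduct.includeRight : MvPolynomial (Fin q) Z →ₐ[Z] SkewPoly Z D q).toRingHom)
    (Subring.center (SkewRatFunc Z D q)) (ofPoly_includeRight_mem_center Z D q)

theorem polyToCenter_injective : Function.Injective (polyToCenter Z D q) := by
  intro f g h
  exact includeRight_injective Z D q (ofPoly_injective Z D q (congrArg Subtype.val h))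

/-- The inclusion `Z(X) → Z(D(X))` extending `Z[X] ⊆ D[X]`. -/
def ratFuncToCenter : RatFuncField Z q →+* Subring.center (SkewRatFunc Z D q) :=
  IsFractionRing.lift (polyToCenter_injective Z D q)

/-- `D(X)` is a `Z(X)`-algebra through the inclusion `Z(X) → D(X)` that extends `Z[X] ⊆ D[X]`. -/
instance instAlgebraSkewRatFunc : Algebra (RatFuncField Z q) (SkewRatFunc Z D q) :=
  RingHom.toAlgebra' ((Subring.center (SkewRatFunc Z D q)).subtype.comp (ratFuncToCenter Z D q))
    (fun c x => (Subring.mem_center_iff.mp (ratFuncToCenter Z D q c).2 x).symm)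

theorem algebraMap_algebraMap (f : MvPolynomial (Fin q) Z) :
    algebraMap (RatFuncField Z q) (SkewRatFunc Z D q) (algebraMap _ _ f) =
      ofPoly Z D q (Algebra.TensorProduct.includeRight f) :=
  congrArg Subtype.val (IsFractionRing.lift_algebraMap (polyToCenter_injective Z D q) f)

/-- If `Z` is the centre of `D`, then `Z(X)` is the centre of `D(X)`. -/
instance instIsCentralSkewRatFunc [Algebra.IsCentral Z D] :
    Algebra.IsCentral (RatFuncField Z q) (SkewRatFunc Z D q) where
  out := by
    intro x hx
    rw [Subalgebra.mem_center_iff] at hx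
    obtain ⟨a, s, hs, h⟩ := exists_fraction Z D q x
    obtain ⟨t, f, hf, ht⟩ := exists_mul_eq_includeRight Z D q s hs
    have hfx : ofPoly Z D q (Algebra.TensorProduct.includeRight f) * x = ofPoly Z D q (t * a) := by
      rw [← ht, map_mul, mul_assoc, h, map_mul]
    have hf0 : ofPoly Z D q (Algebra.TensorProduct.includeRight f) ≠ 0 :=
      (map_ne_zero_iff _ (ofPoly_injective Z D q)).mpr
        ((map_ne_zero_iff _ (includeRight_injective Z D q)).mpr hf)
    have hc : t * a ∈ Subalgebra.centralizer Z
        ((Algebra.TensorProduct.includeLeft : D →ₐ[Z] SkewPoly Z D q).range :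
          Set (SkewPoly Z D q)) := by
      rw [Subalgebra.mem_centralizer_iff]
      intro y _
      apply ofPoly_injective Z D q
      rw [map_mul, map_mul (ofPoly Z D q) (t * a), ← hfx, mul_assoc, ← hx, ← mul_assoc,
        ← mul_assoc, ← map_mul, ← map_mul, (includeRight_commute Z D q f y).eq]
    rw [Subalgebra.centralizer_coe_range_includeLeft_eq_center_tensorProduct] at hc
    obtain ⟨w, hw⟩ := hc
    have hg : ∀ w, ∃ g : MvPolynomial (Fin q) Z,
        Algebra.TensorProduct.map (Subalgebra.center Z D).val
          (AlgHom.id Z (MvPolynomial (Fin q) Z)) w = Algebra.TensorProduct.includeRight g := by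
      intro w
      induction w using TensorProduct.induction_on with
      | zero => exact ⟨0, by simp⟩
      | add u v hu hv =>
        obtain ⟨g, hg⟩ := hu
        obtain ⟨g', hg'⟩ := hv
        exact ⟨g + g', by rw [map_add, map_add, hg, hg']⟩
      | tmul d p =>
        obtain ⟨z, hz⟩ := Algebra.IsCentral.mem_center_iff Z |>.mp d.2
        refine ⟨z • p, ?_⟩
        simp [hz, Algebra.algebraMap_eq_smul_one, TensorProduct.smul_tmul]
    obtain ⟨g, hg⟩ := hg w
    rw [Algebra.mem_bot]
    refine ⟨algebraMap _ _ g / algebraMap _ _ f, ?_⟩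
    have hta : t * a = Algebra.TensorProduct.includeRight g := hw.symm.trans hg
    rw [map_div₀, algebraMap_algebraMap, algebraMap_algebraMap, ← hta, ← hfx, hx, mul_div_assoc,
      div_self hf0, mul_one]

end Construction

section General

variable (F A : Type*) [Field F] [Ring A] [Algebra F A]

/-- The exponent of a central simple algebra `A` over `F`, i.e. the order of its class in the
Brauer group of `F`: the smallest `n ≥ 1` such that the `n`-th tensor power of `A` over `F` is
isomorphic to a matrix algebra `M_N(F)`, `N ≥ 1`. As for the order of an element of a group, the
value `0` means that there is no such `n`. -/
def brauerExponent : ℕ :=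
  sInf {n : ℕ | 1 ≤ n ∧ ∃ N : ℕ, 1 ≤ N ∧
    Nonempty ((⨂[F] _ : Fin n, A) ≃ₐ[F] Matrix (Fin N) (Fin N) F)}

end General

/-- A field extension `K / F` is purely inseparable of exponent `r`: `r` is the smallest natural
number such that `a ^ p ^ r ∈ F` for all `a ∈ K`, where `p` is the characteristic exponent of
`F`. -/
def IsPurelyInseparableOfExponent (F K : Type*) [Field F] [Field K] [Algebra F K] (r : ℕ) : Prop :=
  IsPurelyInseparable F K ∧
    ∃ _ : IsPurelyInseparable.HasExponent F K, IsPurelyInseparable.exponent F K = r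

/-- A maximal subfield of a division ring `A` with centre `F`: a subfield `K` which is its own
centralizer. (A subset which is its own centralizer contains the centre, is commutative, and is
closed under the ring operations and inverses.) -/
structure MaximalSubfield (F A : Type*) [Field F] [DivisionRing A] [Algebra F A] extends
    Subalgebra F A where
  centralizer_eq : Subalgebra.centralizer F (toSubalgebra : Set A) = toSubalgebra

namespace MaximalSubfield

variable {F A : Type*} [Field F] [DivisionRing A] [Algebra F A]

instance : CoeSort (MaximalSubfield F A) (Type _) := ⟨fun K => K.toSubalgebra⟩

theorem mem_iff (K : MaximalSubfield F A) (x : A) :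
    x ∈ K.toSubalgebra ↔ ∀ y ∈ K.toSubalgebra, y * x = x * y := by
  conv_lhs => rw [← K.centralizer_eq]
  exact Subalgebra.mem_centralizer_iff F

instance (K : MaximalSubfield F A) : Field K.toSubalgebra :=
  { (inferInstance : Ring K.toSubalgebra) with
    mul_comm := fun x y => Subtype.ext ((K.mem_iff y).mp y.2 x x.2)
    inv := fun x => ⟨(x : A)⁻¹, (K.mem_iff _).mpr fun y hy => by
      have h : Commute y (x : A) := (K.mem_iff x).mp x.2 y hy
      exact h.inv_right₀⟩
    exists_pair_ne := exists_pair_ne _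
    mul_inv_cancel := fun x hx => Subtype.ext
      (mul_inv_cancel₀ (fun h => hx (Subtype.ext h)))
    inv_zero := Subtype.ext inv_zero
    nnqsmul := _
    nnqsmul_def := fun _ _ => rfl
    qsmul := _
    qsmul_def := fun _ _ => rfl }

end MaximalSubfield

end

end SkewRational

/-! Clearing denominators, which can be taken in `Z[X]`, gives `D(X) ≅ Z(X) ⊗ D`
(`baseChangeEquiv`). Dimensions therefore agree, and the remaining claims compare `D` with its
scalar extension from `Z` to `F = Z(X)`.

Going up is formal: for a maximal subfield `L` of `D`, the centralizer of `1 ⊗ L` in `F ⊗ D` is `F ⊗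
L`, so `F ⊗ L` is a maximal subfield. Its automorphisms and its exponent are read off from `L`.

Going down is by specialisation. If `Z` is finite, Wedderburn's theorem makes `D = Z` and everything
is trivial. If `Z` is infinite, each finitely generated `Z`-subalgebra `O` of `F` has a `Z`-point:
evaluate where a common denominator does not vanish (`nonempty_adjoin_algHom`). This yields a
retraction `ρ` of `B = O ⊗ D` onto `D`, and `O` may be enlarged to contain any finite set of
coefficients (`exists_specialization`). A property of `K ⊆ D(X)` then passes to `L = ρ(K ∩ B)` as
soon as finitely many elements and linear maps witness it: self-centralization by a linear formula
that recovers an element modulo `K` from its commutators (`exists_commutator_decomposition`),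
nontriviality of an automorphism by an inverse of some `σ y - y`, failure of a smaller exponent by a
linear functional, and splitting of a tensor power by matrix units. -/

namespace SkewRational

/-! ### Integral forms of a scalar extension and their specialisations -/

section Specialization

variable {Z F E A : Type*} [Field Z] [Field F] [Algebra Z F] [Ring E] [Algebra Z E]
  [Ring A] [Algebra F A] [Algebra Z A] [IsScalarTower Z F A]

/-- The map `O ⊗ E → A` for a subalgebra `O` of `F` and `A ≅ F ⊗ E`. -/
noncomputable def integralMap (e : F ⊗[Z] E ≃ₐ[F] A) (O : Subalgebra Z F) : O ⊗[Z] E →ₐ[Z] A :=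
  (e.restrictScalars Z).toAlgHom.comp (Algebra.TensorProduct.map O.val (AlgHom.id Z E))

theorem integralMap_tmul (e : F ⊗[Z] E ≃ₐ[F] A) (O : Subalgebra Z F) (o : O) (d : E) :
    integralMap e O (o ⊗ₜ d) = e ((o : F) ⊗ₜ d) := rfl

theorem integralMap_injective (e : F ⊗[Z] E ≃ₐ[F] A) (O : Subalgebra Z F) :
    Function.Injective (integralMap e O) :=
  e.injective.comp (Module.Flat.rTensor_preserves_injective_linearMap (M := E)
    O.val.toLinearMap Subtype.val_injective)

/-- A tensor is a finite sum, so only finitely many coefficients from `F` occur in it. -/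
theorem exists_finset_mem_range_integralMap (e : F ⊗[Z] E ≃ₐ[F] A) (a : A) :
    ∃ S : Finset F, ∀ O : Subalgebra Z F, (S : Set F) ⊆ O → a ∈ (integralMap e O).range := by
  classical
  obtain ⟨t, rfl⟩ := e.surjective a
  induction t using TensorProduct.induction_on with
  | zero => exact ⟨∅, fun O _ => by rw [map_zero]; exact zero_mem _⟩
  | tmul f d =>
    refine ⟨{f}, fun O hO => ⟨(⟨f, hO (by simp)⟩ : O) ⊗ₜ d, rfl⟩⟩
  | add x y hx hy =>
    obtain ⟨S, hS⟩ := hx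
    obtain ⟨T, hT⟩ := hy
    refine ⟨S ∪ T, fun O hO => ?_⟩
    rw [Finset.coe_union, Set.union_subset_iff] at hO
    rw [map_add]
    exact add_mem (hS O hO.1) (hT O hO.2)

/-- An `F`-linear map is determined by its values on a `Z`-basis of `E`. Once these finitely many
values are integral over `O` in the sense of lying in `O ⊗ E`, the map acts `O`-linearly on all of
`O ⊗ E`. -/
theorem linearMap_mem_range_integralMap [FiniteDimensional Z E] (e : F ⊗[Z] E ≃ₐ[F] A)
    (O : Subalgebra Z F) (ψ : A →ₗ[F] A)
    (h : ∀ i, ψ (e (1 ⊗ₜ Module.finBasis Z E i)) ∈ (integralMap e O).range) :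
    ∃ Ψ : E →ₗ[Z] O ⊗[Z] E, ∀ (o : O) (d : E),
      ψ (integralMap e O (o ⊗ₜ d)) = integralMap e O ((o ⊗ₜ 1) * Ψ d) := by
  choose t ht using h
  let Ψ : E →ₗ[Z] O ⊗[Z] E := (Module.finBasis Z E).constr Z t
  have hΨ : ∀ d, ψ (e (1 ⊗ₜ d)) = integralMap e O (Ψ d) := by
    have : (ψ.restrictScalars Z) ∘ₗ ((e.restrictScalars Z).toLinearMap ∘ₗ
        (Algebra.TensorProduct.includeRight : E →ₐ[Z] F ⊗[Z] E).toLinearMap) =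
        (integralMap e O).toLinearMap ∘ₗ Ψ := by
      refine (Module.finBasis Z E).ext fun i => ?_
      simp only [LinearMap.comp_apply, Ψ, Module.Basis.constr_basis]
      exact (ht i).symm
    exact fun d => LinearMap.congr_fun this d
  refine ⟨Ψ, fun o d => ?_⟩
  have h1 : (o : F) ⊗ₜ[Z] d = (o : F) • ((1 : F) ⊗ₜ[Z] d) := by
    rw [TensorProduct.smul_tmul', smul_eq_mul, mul_one]
  have h2 : e ((o : F) ⊗ₜ[Z] (1 : E)) = algebraMap F A o := by
    rw [← e.commutes]; rfl
  rw [integralMap_tmul, h1, map_smul, map_smul, hΨ, map_mul, integralMap_tmul, h2,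
    Algebra.smul_def]

/-- Specialisation: an `F`-algebra `A ≅ F ⊗ E` has a `Z`-subalgebra that contains `E` and finitely
many given elements, is stable under finitely many given `F`-linear maps, and retracts onto `E`. -/
theorem exists_specialization [FiniteDimensional Z E] [Nontrivial E] (e : F ⊗[Z] E ≃ₐ[F] A)
    (hF : ∀ S : Finset F, Nonempty (Algebra.adjoin Z (S : Set F) →ₐ[Z] Z))
    (s : Set A) (hs : s.Finite) (Ψ : Set (A →ₗ[F] A)) (hΨ : Ψ.Finite) :
    ∃ (B : Subalgebra Z A) (ρ : B →ₐ[Z] E),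
      (∀ d : E, ∃ h : e (1 ⊗ₜ d) ∈ B, ρ ⟨_, h⟩ = d) ∧ s ⊆ B ∧
      (∀ ψ ∈ Ψ, ∀ b ∈ B, ψ b ∈ B) ∧
      (∀ ψ ∈ Ψ, ∀ b b' : B, ψ b = b' → ρ b = 0 → ρ b' = 0) ∧
      (∀ (c : F) (b : B), (b : A) = algebraMap F A c → ∃ z : Z, ρ b = algebraMap Z E z) := by
  classical
  choose S hS using exists_finset_mem_range_integralMap e
  let b := Module.finBasis Z E
  -- The coefficients of the given elements, and of the values of the given maps on a basis of `E`.
  let T : Finset F := hs.toFinset.biUnion S ∪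
    hΨ.toFinset.biUnion fun ψ => Finset.univ.biUnion fun i => S (ψ (e (1 ⊗ₜ b i)))
  obtain ⟨ev⟩ := hF T
  let O := Algebra.adjoin Z (T : Set F)
  have hTO : (T : Set F) ⊆ O := Algebra.subset_adjoin
  let j := integralMap e O
  have hj : Function.Injective j := integralMap_injective e O
  let E' : O ⊗[Z] E →ₐ[Z] E :=
    (Algebra.TensorProduct.lid Z E).toAlgHom.comp (Algebra.TensorProduct.map ev (AlgHom.id Z E))
  have hE' : ∀ (o : O) (d : E), E' (o ⊗ₜ d) = ev o • d := fun o d => by simp [E']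
  let q := AlgEquiv.ofInjective j hj
  have hq : ∀ t, (q t : A) = j t := fun t => rfl
  have hs' : ∀ a ∈ s, a ∈ j.range := fun a ha => hS a O (subset_trans (by
    intro x hx
    simp only [T, Finset.coe_union, Set.mem_union]
    left
    simp only [Finset.coe_biUnion, Set.mem_iUnion]
    exact ⟨a, by simpa using ha, hx⟩) hTO)
  have hψ : ∀ ψ ∈ Ψ, ∀ i, ψ (e (1 ⊗ₜ b i)) ∈ j.range := fun ψ h i => hS _ O (subset_trans (by
    intro x hx
    simp only [T, Finset.coe_union, Set.mem_union]
    right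
    simp only [Finset.coe_biUnion, Set.mem_iUnion]
    exact ⟨ψ, by simpa using h, i, by simp, hx⟩) hTO)
  -- By `O`-linearity each `ψ` induces a `Z`-linear map `φ` on the specialisation. Hence `ψ`
  -- preserves both `B` and the kernel of `ρ`.
  have key : ∀ ψ ∈ Ψ, ∃ φ : E →ₗ[Z] E, ∀ t, ∃ t', ψ (j t) = j t' ∧ E' t' = φ (E' t) := by
    intro ψ h
    obtain ⟨Φ, hΦ⟩ := linearMap_mem_range_integralMap e O ψ (hψ ψ h)
    refine ⟨E'.toLinearMap ∘ₗ Φ, fun t => ?_⟩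
    induction t using TensorProduct.induction_on with
    | zero => exact ⟨0, by simp, by simp⟩
    | tmul o d =>
      refine ⟨_, hΦ o d, ?_⟩
      rw [map_mul, hE', hE']
      simp
    | add x y hx hy =>
      obtain ⟨x', h1, h2⟩ := hx
      obtain ⟨y', h3, h4⟩ := hy
      exact ⟨x' + y', by simp [h1, h3], by simp [h2, h4]⟩
  refine ⟨j.range, E'.comp q.symm.toAlgHom, ?_, hs', ?_, ?_, ?_⟩
  · intro d
    have h1 : q (1 ⊗ₜ d) = e (1 ⊗ₜ d) := rfl
    refine ⟨⟨1 ⊗ₜ d, rfl⟩, ?_⟩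
    change E' (q.symm (q (1 ⊗ₜ d))) = d
    rw [q.symm_apply_apply, hE', map_one, one_smul]
  · rintro ψ h _ ⟨t, rfl⟩
    obtain ⟨φ, hφ⟩ := key ψ h
    obtain ⟨t', h1, -⟩ := hφ t
    exact ⟨t', h1.symm⟩
  · intro ψ h x x' hx h0
    obtain ⟨φ, hφ⟩ := key ψ h
    obtain ⟨t, rfl⟩ := q.surjective x
    obtain ⟨t', h1, h2⟩ := hφ t
    have : q t' = x' := Subtype.ext (h1.symm.trans hx)
    subst this
    change E' (q.symm (q t)) = 0 at h0
    change E' (q.symm (q t')) = 0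
    rw [q.symm_apply_apply] at h0 ⊢
    rw [h2, h0, map_zero]
  · intro c x hx
    obtain ⟨t, rfl⟩ := q.surjective x
    -- A functional `l` on `E` with `l 1 = 1` reads off the scalar of an element of `F · 1`. Applied
    -- to `t`, it shows that `c` already lies in `O`, so that `t = c ⊗ 1` specialises to a scalar.
    obtain ⟨l, hl⟩ := (Algebra.linearMap Z E).exists_leftInverse_of_injective
      (LinearMap.ker_eq_bot.mpr (algebraMap Z E).injective)
    have hl1 : l 1 = 1 := by
      have := LinearMap.congr_fun hl 1
      simpa using this
    have hc : ((TensorProduct.rid Z O (l.lTensor O t) : O) : F) = c := by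
      have h3 : ∀ t, ((TensorProduct.rid Z O (l.lTensor O t) : O) : F) =
          TensorProduct.rid Z F (l.lTensor F (e.symm (j t))) := by
        intro t
        induction t using TensorProduct.induction_on with
        | zero => simp
        | tmul o d => simp [j, integralMap_tmul]
        | add x y hx hy => simp [hx, hy]
      rw [h3]
      have : e.symm (j t) = c ⊗ₜ 1 := by
        rw [e.symm_apply_eq]
        exact hx.trans (e.commutes c).symm
      rw [this]
      simp [hl1]
    have ht : t = (TensorProduct.rid Z O (l.lTensor O t)) ⊗ₜ 1 := by
      apply hj
      refine Eq.trans (b := algebraMap F A c) hx ?_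
      change _ = integralMap e O _
      rw [integralMap_tmul, hc]
      exact (e.commutes c).symm
    refine ⟨ev (TensorProduct.rid Z O (l.lTensor O t)), ?_⟩
    change E' (q.symm (q t)) = _
    rw [q.symm_apply_apply, ht, hE', ← ht, Algebra.algebraMap_eq_smul_one]

end Specialization


/-! ### Rational points of finitely generated algebras of rational functions -/

section FractionField

/-- A finitely generated algebra of rational functions over an infinite field has a rational
point. -/
theorem nonempty_adjoin_algHom {Z : Type*} [Field Z] [Infinite Z] {q : ℕ}
    (S : Finset (RatFuncField Z q)) :
    Nonempty (Algebra.adjoin Z (S : Set (RatFuncField Z q)) →ₐ[Z] Z) := by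
  obtain ⟨g, hg⟩ := IsLocalization.exist_integer_multiples_of_finset
    (MvPolynomial (Fin q) Z)⁰ S
  -- Over an infinite field a nonzero polynomial, here the common denominator `g`, is nonzero at
  -- some point.
  obtain ⟨x, hx⟩ : ∃ x, MvPolynomial.eval x (g : MvPolynomial (Fin q) Z) ≠ 0 := by
    by_contra! h
    exact nonZeroDivisors.ne_zero g.2 (MvPolynomial.funext fun x => by rw [h, map_zero])
  let M := Submonoid.powers (g : MvPolynomial (Fin q) Z)
  have hM : M ≤ (MvPolynomial (Fin q) Z)⁰ := Submonoid.powers_le.mpr g.2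
  let L := Localization.subalgebra.ofField (RatFuncField Z q) M hM
  have hgL : ∀ y : M, IsUnit ((MvPolynomial.aeval x : MvPolynomial (Fin q) Z →ₐ[Z] Z) y) := by
    rintro ⟨_, n, rfl⟩
    rw [map_pow]
    exact (IsUnit.mk0 _ (by simpa using hx)).pow n
  let f : L →ₐ[Z] Z := IsLocalization.liftAlgHom (M := M) (f := MvPolynomial.aeval x) hgL
  have hSL : Algebra.adjoin Z (S : Set (RatFuncField Z q)) ≤ L.restrictScalars Z := by
    rw [Algebra.adjoin_le_iff]
    intro a ha
    obtain ⟨r, hr⟩ := hg a ha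
    refine ⟨r, g, ⟨1, pow_one _⟩, ?_⟩
    have hg0 : algebraMap (MvPolynomial (Fin q) Z) (RatFuncField Z q) g ≠ 0 :=
      IsFractionRing.to_map_ne_zero_of_mem_nonZeroDivisors g.2
    rw [hr, eq_mul_inv_iff_mul_eq₀ hg0, mul_comm, Algebra.smul_def]
  exact ⟨f.comp (Subalgebra.inclusion hSL)⟩

end FractionField

/-! ### `D(X)` as a scalar extension of `D` -/

section BaseChange

/-- Finitely many fractions have a common denominator. This reduces injectivity of `baseChangeHom`
to injectivity of `D[X] → D(X)`. -/
theorem exists_smul_eq_map (Z D : Type*) [Field Z] [DivisionRing D] [Algebra Z D] (q : ℕ)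
    (t : RatFuncField Z q ⊗[Z] D) :
    ∃ (g : MvPolynomial (Fin q) Z) (w : SkewPoly Z D q), g ≠ 0 ∧
      algebraMap _ (RatFuncField Z q) g • t = TensorProduct.comm Z D (RatFuncField Z q)
        ((IsScalarTower.toAlgHom Z (MvPolynomial (Fin q) Z) (RatFuncField Z q)).toLinearMap.lTensor
          D w) := by
  induction t using TensorProduct.induction_on with
  | zero => exact ⟨1, 0, one_ne_zero, by simp⟩
  | tmul c d =>
    obtain ⟨a, s, hs, rfl⟩ := IsFractionRing.div_surjective (MvPolynomial (Fin q) Z) c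
    refine ⟨s, d ⊗ₜ a, nonZeroDivisors.ne_zero hs, ?_⟩
    have hs0 := IsFractionRing.to_map_ne_zero_of_mem_nonZeroDivisors
      (K := RatFuncField Z q) hs
    rw [TensorProduct.smul_tmul', smul_eq_mul, mul_div_cancel₀ _ hs0]
    rfl
  | add x y hx hy =>
    obtain ⟨g, w, hg, h1⟩ := hx
    obtain ⟨g', w', hg', h2⟩ := hy
    have h : ∀ (f : MvPolynomial (Fin q) Z) (w : SkewPoly Z D q),
        algebraMap _ (RatFuncField Z q) f • TensorProduct.comm Z D (RatFuncField Z q)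
        ((IsScalarTower.toAlgHom Z (MvPolynomial (Fin q) Z) (RatFuncField Z q)).toLinearMap.lTensor
          D w) = TensorProduct.comm Z D (RatFuncField Z q)
        ((IsScalarTower.toAlgHom Z (MvPolynomial (Fin q) Z) (RatFuncField Z q)).toLinearMap.lTensor
          D (w * Algebra.TensorProduct.includeRight f)) := by
      intro f w
      induction w using TensorProduct.induction_on with
      | zero => simp
      | tmul d p => simp [TensorProduct.smul_tmul', mul_comm, Algebra.smul_def]
      | add x y hx hy => rw [map_add, map_add, smul_add, hx, hy, add_mul, map_add, map_add]
    refine ⟨g * g', w * Algebra.TensorProduct.includeRight g' +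
      w' * Algebra.TensorProduct.includeRight g, mul_ne_zero hg hg', ?_⟩
    rw [map_add, map_add, ← h, ← h, ← h1, ← h2, smul_smul, smul_smul, smul_add, map_mul,
      mul_comm (algebraMap _ _ g')]

variable (Z D : Type*) [Field Z] [DivisionRing D] [Algebra Z D] [FiniteDimensional Z D] (q : ℕ)

noncomputable instance instAlgebraBaseSkewRatFunc : Algebra Z (SkewRatFunc Z D q) :=
  Algebra.compHom _ (algebraMap Z (RatFuncField Z q))

instance instIsScalarTowerSkewRatFunc :
    IsScalarTower Z (RatFuncField Z q) (SkewRatFunc Z D q) :=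
  IsScalarTower.of_algebraMap_eq fun _ => rfl

/-- The inclusion `D[X] → D(X)` as a homomorphism of `Z`-algebras. -/
noncomputable def ofPolyAlgHom : SkewPoly Z D q →ₐ[Z] SkewRatFunc Z D q :=
  { ofPoly Z D q with
    commutes' := fun z => by
      have h1 : algebraMap Z (SkewPoly Z D q) z =
          Algebra.TensorProduct.includeRight (algebraMap Z (MvPolynomial (Fin q) Z) z) := by
        rw [AlgHom.commutes]
      change ofPoly Z D q _ = _
      rw [h1, ← algebraMap_algebraMap, ← IsScalarTower.algebraMap_apply Z _ (RatFuncField Z q)]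
      rfl }

/-- The natural map `Z(X) ⊗ D → D(X)`. -/
noncomputable def baseChangeHom :
    RatFuncField Z q ⊗[Z] D →ₐ[RatFuncField Z q] SkewRatFunc Z D q :=
  Algebra.TensorProduct.lift (Algebra.ofId _ _)
    ((ofPolyAlgHom Z D q).comp Algebra.TensorProduct.includeLeft)
    fun c _ => Algebra.commutes c _

theorem baseChangeHom_tmul (c : RatFuncField Z q) (d : D) :
    baseChangeHom Z D q (c ⊗ₜ d) = algebraMap _ _ c * ofPoly Z D q (d ⊗ₜ 1) := rfl

theorem baseChangeHom_algebraMap_tmul (f : MvPolynomial (Fin q) Z) (d : D) :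
    baseChangeHom Z D q (algebraMap _ _ f ⊗ₜ d) = ofPoly Z D q (d ⊗ₜ f) := by
  rw [baseChangeHom_tmul, algebraMap_algebraMap, ← map_mul]
  simp

theorem baseChangeHom_injective : Function.Injective (baseChangeHom Z D q) := by
  rw [injective_iff_map_eq_zero]
  intro t ht
  obtain ⟨g, w, hg, h⟩ := exists_smul_eq_map Z D q t
  have key : ∀ w : SkewPoly Z D q, baseChangeHom Z D q (TensorProduct.comm Z D (RatFuncField Z q)
      ((IsScalarTower.toAlgHom Z (MvPolynomial (Fin q) Z) (RatFuncField Z q)).toLinearMap.lTensor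
        D w)) = ofPoly Z D q w := by
    intro w
    induction w using TensorProduct.induction_on with
    | zero => simp
    | tmul d p => exact baseChangeHom_algebraMap_tmul Z D q p d
    | add x y hx hy => rw [map_add, map_add, map_add, hx, hy, map_add]
  have h0 := key w
  rw [← h, map_smul, ht, smul_zero, eq_comm, map_eq_zero_iff _ (ofPoly_injective Z D q)] at h0
  rw [h0, map_zero, map_zero] at h
  exact (smul_eq_zero.mp h).resolve_left
    ((map_ne_zero_iff _ (IsFractionRing.injective _ _)).mpr hg)

/-- A left fraction over `D[X]` can be rewritten with its denominator in `Z[X]`, by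
`exists_mul_eq_includeRight`, and such a denominator is a scalar from `Z(X)`. -/
theorem baseChangeHom_surjective : Function.Surjective (baseChangeHom Z D q) := by
  intro x
  obtain ⟨a, s, hs, h⟩ := exists_fraction Z D q x
  obtain ⟨t, f, hf, ht⟩ := exists_mul_eq_includeRight Z D q s hs
  have hP : ∀ y, ofPoly Z D q y ∈ (baseChangeHom Z D q).range := by
    intro y
    induction y using TensorProduct.induction_on with
    | zero => rw [map_zero]; exact zero_mem _
    | tmul d p => exact ⟨_, baseChangeHom_algebraMap_tmul Z D q p d⟩
    | add x y hx hy => rw [map_add]; exact add_mem hx hy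
  have hf0 : algebraMap (MvPolynomial (Fin q) Z) (RatFuncField Z q) f ≠ 0 :=
    (map_ne_zero_iff _ (IsFractionRing.injective _ _)).mpr hf
  have hfx : algebraMap (MvPolynomial (Fin q) Z) (RatFuncField Z q) f • x =
      ofPoly Z D q (t * a) := by
    rw [Algebra.smul_def, algebraMap_algebraMap, ← ht, map_mul, mul_assoc, h, map_mul]
  have : x = (algebraMap (MvPolynomial (Fin q) Z) (RatFuncField Z q) f)⁻¹ •
      ofPoly Z D q (t * a) := by
    rw [← hfx, smul_smul, inv_mul_cancel₀ hf0, one_smul]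
  rw [this]
  exact (baseChangeHom Z D q).range.smul_mem (hP _) _

/-- `D(X)` is obtained from `D` by extending scalars from `Z` to `Z(X)`. -/
noncomputable def baseChangeEquiv :
    RatFuncField Z q ⊗[Z] D ≃ₐ[RatFuncField Z q] SkewRatFunc Z D q :=
  AlgEquiv.ofBijective (baseChangeHom Z D q)
    ⟨baseChangeHom_injective Z D q, baseChangeHom_surjective Z D q⟩

theorem finrank_skewRatFunc :
    Module.finrank (RatFuncField Z q) (SkewRatFunc Z D q) = Module.finrank Z D := by
  rw [← (baseChangeEquiv Z D q).toLinearEquiv.finrank_eq, Module.finrank_baseChange]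

/-- A finite-dimensional central division algebra over a finite field is trivial. -/
theorem finrank_eq_one_of_finite [Finite Z] [Algebra.IsCentral Z D] : Module.finrank Z D = 1 := by
  have : Finite D := Module.finite_of_finite Z
  have hc : ∀ x y : D, x * y = y * x := (littleWedderburn D).mul_comm
  rw [← Subalgebra.bot_eq_top_iff_finrank_eq_one, ← Algebra.IsCentral.center_eq_bot Z D,
    eq_top_iff]
  intro x _
  rw [Subalgebra.mem_center_iff]
  exact fun y => hc y x

end BaseChange


/-- The image of a subalgebra of `A` under a homomorphism that is defined on a subring `B`. -/
def specialize {Z F E A : Type*} [Field Z] [Field F] [Algebra Z F] [Ring E] [Algebra Z E]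
    [Ring A] [Algebra F A] [Algebra Z A] [IsScalarTower Z F A]
    (K : Subalgebra F A) (B : Subalgebra Z A) (ρ : B →ₐ[Z] E) : Subalgebra Z E :=
  ((K.restrictScalars Z).comap B.val).map ρ

theorem mem_specialize {Z F E A : Type*} [Field Z] [Field F] [Algebra Z F] [Ring E] [Algebra Z E]
    [Ring A] [Algebra F A] [Algebra Z A] [IsScalarTower Z F A]
    {K : Subalgebra F A} {B : Subalgebra Z A} {ρ : B →ₐ[Z] E} {x : E} :
    x ∈ specialize K B ρ ↔ ∃ b : B, (b : A) ∈ K ∧ ρ b = x := Iff.rfl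

/-! ### Specialising a maximal subfield -/

section Descent

variable {Z F D A : Type*} [Field Z] [Field F] [Algebra Z F] [DivisionRing D] [Algebra Z D]
  [DivisionRing A] [Algebra F A] [Algebra Z A] [IsScalarTower Z F A]

theorem exists_projection (K : Subalgebra F A) :
    ∃ π : A →ₗ[F] A, (∀ a, π a ∈ K) ∧ ∀ a ∈ K, π a = a := by
  obtain ⟨g, hg⟩ := (Subalgebra.toSubmodule K).subtype.exists_leftInverse_of_injective
    (Submodule.ker_subtype _)
  refine ⟨(Subalgebra.toSubmodule K).subtype ∘ₗ g, fun a => (g a).2, fun a ha => ?_⟩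
  exact congrArg Subtype.val (LinearMap.congr_fun hg ⟨a, ha⟩)

/-- An element is recovered up to an element of `K` from its commutators with a basis of `K`. -/
theorem exists_commutator_decomposition (K : MaximalSubfield F A) {ι : Type*} [Fintype ι]
    (κ : Module.Basis ι F K) (π : A →ₗ[F] A) (hπ : ∀ a ∈ K.toSubalgebra, π a = a) :
    ∃ ψ : ι → A →ₗ[F] A, ∀ a,
      a = π a + ∑ i, ψ i (a * κ i - κ i * a) := by
  classical
  let ad : A →ₗ[F] (ι → A) := LinearMap.pi fun i =>
    LinearMap.mulRight F (κ i : A) - LinearMap.mulLeft F (κ i : A)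
  -- The kernel of `ad` is the centralizer of `K`, hence `K` itself, where `π` is the identity. So
  -- `id - π` factors through `ad`, and the factor extends from the range of `ad` to the whole
  -- product.
  have hker : LinearMap.ker ad ≤ LinearMap.ker (LinearMap.id - π) := by
    intro a ha
    rw [LinearMap.mem_ker, LinearMap.sub_apply, LinearMap.id_apply, sub_eq_zero, eq_comm]
    apply hπ
    rw [K.mem_iff]
    have h1 : ∀ i, (κ i : A) * a = a * κ i := fun i => by
      have := congrFun ha i
      simp only [ad, LinearMap.pi_apply, LinearMap.sub_apply, LinearMap.mulRight_apply,
        LinearMap.mulLeft_apply, Pi.zero_apply, sub_eq_zero] at this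
      exact this.symm
    intro y hy
    have h2 : (⟨y, hy⟩ : K) ∈ Submodule.span F (Set.range κ) := by
      rw [κ.span_eq]; trivial
    have h3 : ∀ z : K, z ∈ Submodule.span F (Set.range κ) → (z : A) * a = a * z := by
      intro z hz
      induction hz using Submodule.span_induction with
      | mem x hx => obtain ⟨i, rfl⟩ := hx; exact h1 i
      | zero => simp
      | add x y _ _ hx hy => simp [add_mul, mul_add, hx, hy]
      | smul c x _ hx => simp [hx]
    exact h3 _ h2
  obtain ⟨ψ, hψ⟩ := (LinearMap.exists_extend (p := LinearMap.range ad)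
    (((LinearMap.ker ad).liftQ (LinearMap.id - π) hker) ∘ₗ
      ad.quotKerEquivRange.symm.toLinearMap))
  refine ⟨fun i => ψ ∘ₗ LinearMap.single F (fun _ => A) i, fun a => ?_⟩
  have h4 : ψ (ad a) = a - π a := by
    have := LinearMap.congr_fun hψ ⟨ad a, a, rfl⟩
    have h5 : ad.quotKerEquivRange.symm ⟨ad a, a, rfl⟩ = (LinearMap.ker ad).mkQ a := by
      rw [LinearEquiv.symm_apply_eq]
      rfl
    simp only [LinearMap.comp_apply, LinearEquiv.coe_coe, h5] at this
    exact this
  have h6 : ∑ i, (ψ ∘ₗ LinearMap.single F (fun _ => A) i) (a * κ i - κ i * a) = ψ (ad a) := by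
    simp only [LinearMap.comp_apply]
    rw [← map_sum]
    congr 1
    exact Finset.univ_sum_single (ad a)
  rw [h6, h4, add_sub_cancel]

/-- The set `ρ(K ∩ B)` is commutative because `K` is. It is its own centralizer because the
commutator decomposition, made integral on `B`, survives specialisation. It is spanned by the images
of a basis of `K`, which bounds its dimension. -/
theorem exists_maximalSubfield_specialization [FiniteDimensional Z D] (e : F ⊗[Z] D ≃ₐ[F] A)
    (hF : ∀ S : Finset F, Nonempty (Algebra.adjoin Z (S : Set F) →ₐ[Z] Z))
    (K : MaximalSubfield F A) (s : Set A) (hs : s.Finite) (Ψ : Set (A →ₗ[F] A))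
    (hΨ : Ψ.Finite) :
    ∃ (B : Subalgebra Z A) (ρ : B →ₐ[Z] D), s ⊆ B ∧
      (∀ ψ ∈ Ψ, ∀ b ∈ B, ψ b ∈ B) ∧
      (∀ ψ ∈ Ψ, ∀ b b' : B, ψ b = b' → ρ b = 0 → ρ b' = 0) ∧
      (∀ (c : F) (b : B), (b : A) = algebraMap F A c → ∃ z : Z, ρ b = algebraMap Z D z) ∧
      ∃ L : MaximalSubfield Z D, L.toSubalgebra = specialize K.toSubalgebra B ρ ∧
        Module.finrank Z L ≤ Module.finrank F K := by
  have : FiniteDimensional F A := Module.Finite.equiv e.toLinearEquiv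
  obtain ⟨π, hπK, hπ⟩ := exists_projection K.toSubalgebra
  let κ := Module.finBasis F K
  obtain ⟨ψ, hψ⟩ := exists_commutator_decomposition K κ π hπ
  obtain ⟨g, hg⟩ := (Subalgebra.toSubmodule K.toSubalgebra).subtype.exists_leftInverse_of_injective
    (Submodule.ker_subtype _)
  have hg' : ∀ y : K, g y = y := fun y => LinearMap.congr_fun hg y
  -- Coordinates with respect to `κ`, viewed in `A`. Stability under these maps keeps the
  -- coordinates of an element of `K ∩ B` inside `B`, where they specialise to scalars of `Z`.
  let φ : Fin (Module.finrank F K) → A →ₗ[F] A := fun i =>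
    Algebra.linearMap F A ∘ₗ κ.coord i ∘ₗ g
  obtain ⟨B, ρ, h1, h2, h3, h4, h5⟩ := exists_specialization e hF (s ∪ Set.range fun i => (κ i : A))
    (hs.union (Set.finite_range _)) (Ψ ∪ (Set.range ψ ∪ Set.range φ))
    (hΨ.union ((Set.finite_range _).union (Set.finite_range _)))
  rw [Set.union_subset_iff] at h2
  have hκ : ∀ i, (κ i : A) ∈ B := fun i => h2.2 ⟨i, rfl⟩
  refine ⟨B, ρ, h2.1, fun p hp => h3 p (Or.inl hp), fun p hp => h4 p (Or.inl hp), h5,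
    ⟨specialize K.toSubalgebra B ρ, ?_⟩, rfl, ?_⟩
  · ext d
    rw [Subalgebra.mem_centralizer_iff]
    constructor
    · intro hd
      obtain ⟨a, hdB, hρd⟩ : ∃ (a : A) (h : a ∈ B), ρ ⟨a, h⟩ = d := ⟨_, h1 d⟩
      have hc : ∀ i, ∃ c : B, (c : A) = ψ i (a * κ i - κ i * a) ∧ ρ c = 0 := by
        intro i
        let t : B := ⟨a, hdB⟩ * ⟨κ i, hκ i⟩ - ⟨κ i, hκ i⟩ * ⟨a, hdB⟩
        have ht : ρ t = 0 := by
          have := hd (ρ ⟨κ i, hκ i⟩) (mem_specialize.mpr ⟨⟨κ i, hκ i⟩, (κ i).2, rfl⟩)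
          simp only [t, map_sub, map_mul, hρd]
          rw [this, sub_self]
        have hi : ψ i ∈ Ψ ∪ (Set.range ψ ∪ Set.range φ) := Or.inr (Or.inl ⟨i, rfl⟩)
        exact ⟨⟨ψ i t, h3 _ hi _ t.2⟩, rfl, h4 _ hi t _ rfl ht⟩
      choose c hc1 hc2 using hc
      -- This element equals `π a`, so it lies in `K`. The corrections `c i` come from commutators
      -- killed by `ρ`, so it still specialises to `d`.
      refine mem_specialize.mpr ⟨⟨a, hdB⟩ - ∑ i, c i, ?_, ?_⟩
      · have : ((⟨a, hdB⟩ - ∑ i, c i : B) : A) = π a := by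
          conv_rhs => rw [eq_sub_of_add_eq (hψ a).symm]
          simp [hc1]
        rw [this]
        exact hπK a
      · simp [hρd, hc2]
    · rintro ⟨b, hb, rfl⟩ _ ⟨b', hb', rfl⟩
      have : b' * b = b * b' := Subtype.ext ((K.mem_iff b).mp hb b' hb')
      change ρ b' * ρ b = ρ b * ρ b'
      rw [← map_mul, ← map_mul, this]
  · change Module.finrank Z (Subalgebra.toSubmodule (specialize K.toSubalgebra B ρ)) ≤ _
    have hle : Subalgebra.toSubmodule (specialize K.toSubalgebra B ρ) ≤
        Submodule.span Z (Set.range fun i => ρ ⟨κ i, hκ i⟩) := by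
      rintro _ ⟨b, hb, rfl⟩
      have hφ : ∀ i, ∃ c : B, (c : A) = algebraMap F A (κ.repr ⟨b, hb⟩ i) := by
        intro i
        refine ⟨⟨φ i b, h3 _ (Or.inr (Or.inr ⟨i, rfl⟩)) b b.2⟩, ?_⟩
        change algebraMap F A (κ.repr (g (⟨b, hb⟩ : K)) i) = _
        rw [hg']
      choose c hc using hφ
      choose z hz using fun i => h5 _ _ (hc i)
      have hsum : b = ∑ i, c i * ⟨κ i, hκ i⟩ := by
        apply Subtype.ext
        have := congrArg Subtype.val (κ.sum_repr ⟨b, hb⟩)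
        refine this.symm.trans ?_
        simp [hc, Algebra.smul_def]
      change ρ b ∈ _
      rw [hsum, map_sum]
      refine Submodule.sum_mem _ fun i _ => ?_
      rw [map_mul, hz, ← Algebra.smul_def]
      exact Submodule.smul_mem _ _ (Submodule.subset_span ⟨i, rfl⟩)
    refine (Submodule.finrank_mono hle).trans ((finrank_range_le_card _).trans ?_)
    rw [Fintype.card_fin]

end Descent

/-! ### Transporting automorphism groups -/

section Automorphisms

/-- Endomorphisms that preserve the kernel of `p` descend to the quotient. Since `G` is a group, the
descended endomorphisms are units, hence automorphisms. -/
theorem exists_autHom_of_surjective {Z T L G : Type*} [Field Z] [Ring T] [Algebra Z T] [Ring L]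
    [Algebra Z L] [Group G] (p : T →ₐ[Z] L) (hp : Function.Surjective p) (f : G →* (T →ₐ[Z] T))
    (hf : ∀ g t, p t = 0 → p (f g t) = 0) :
    ∃ θ : G →* (L ≃ₐ[Z] L), ∀ g t, θ g (p t) = p (f g t) := by
  have hf' : ∀ g t t', p t = p t' → p (f g t) = p (f g t') := by
    intro g t t' h
    rw [← sub_eq_zero, ← map_sub] at h ⊢
    rw [← map_sub]
    exact hf g _ h
  let r := Function.surjInv hp
  have hr : ∀ x, p (r x) = x := Function.surjInv_eq hp
  let φ : G → L →ₐ[Z] L := fun g =>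
    { toFun := fun x => p (f g (r x))
      map_one' := (hf' g _ 1 (by rw [hr, map_one])).trans (by simp)
      map_mul' := fun x y => (hf' g _ (r x * r y) (by simp [hr])).trans (by simp)
      map_zero' := (hf' g _ 0 (by rw [hr, map_zero])).trans (by simp)
      map_add' := fun x y => (hf' g _ (r x + r y) (by simp [hr])).trans (by simp)
      commutes' := fun z => (hf' g _ (algebraMap Z T z) (by simp [hr])).trans (by simp) }
  have hφ : ∀ g t, φ g (p t) = p (f g t) := fun g t => hf' g _ _ (hr _)
  let φ' : G →* (L →ₐ[Z] L) :=
    { toFun := φ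
      map_one' := by
        ext x
        obtain ⟨t, rfl⟩ := hp x
        simp [hφ]
      map_mul' := fun g h => by
        ext x
        obtain ⟨t, rfl⟩ := hp x
        simp [hφ] }
  exact ⟨(AlgEquiv.algHomUnitsEquiv Z L).toMonoidHom.comp φ'.toHomUnits, hφ⟩

/-- Counting: `|Aut L| ≤ [L : Z] ≤ [K : F] = |Aut K| ≤ |Aut L|`, so equality holds throughout. -/
theorem isGalois_and_bijective_of_injective {F K Z L : Type*} [Field F] [Field K] [Algebra F K]
    [FiniteDimensional F K] [IsGalois F K] [Field Z] [Field L] [Algebra Z L]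
    [FiniteDimensional Z L] (h : Module.finrank Z L ≤ Module.finrank F K)
    (θ : (K ≃ₐ[F] K) →* (L ≃ₐ[Z] L)) (hθ : Function.Injective θ) :
    IsGalois Z L ∧ Function.Bijective θ := by
  have h1 : Nat.card (L ≃ₐ[Z] L) ≤ Module.finrank Z L := by
    rw [Nat.card_eq_fintype_card]; exact AlgEquiv.card_le
  have h2 := IsGalois.card_aut_eq_finrank F K
  have h3 := Nat.card_le_card_of_injective θ hθ
  exact ⟨IsGalois.of_card_aut_eq_finrank _ _ (by omega),
    (Nat.bijective_iff_injective_and_card θ).mpr ⟨hθ, by omega⟩⟩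

end Automorphisms


/-- An elementwise form of the exponent condition, suited to transport along specialisation and
scalar extension. -/
theorem isPurelyInseparableOfExponent_iff (F K : Type*) [Field F] [Field K] [Algebra F K]
    (p : ℕ) [ExpChar F p] (r : ℕ) :
    IsPurelyInseparableOfExponent F K r ↔ (∀ a : K, a ^ p ^ r ∈ (algebraMap F K).range) ∧
      ∀ s < r, ∃ a : K, a ^ p ^ s ∉ (algebraMap F K).range := by
  constructor
  · rintro ⟨_, _, rfl⟩
    exact ⟨fun a => IsPurelyInseparable.exponent_def' F p a,
      fun s hs => IsPurelyInseparable.exponent_min' p hs⟩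
  · rintro ⟨h1, h2⟩
    have h : IsPurelyInseparable.HasExponent F K :=
      (IsPurelyInseparable.hasExponent_iff' F K p).mpr ⟨r, h1⟩
    refine ⟨inferInstance, h, le_antisymm ?_ ?_⟩
    · by_contra! hlt
      obtain ⟨a, ha⟩ := IsPurelyInseparable.exponent_min' p hlt
      exact ha (h1 a)
    · by_contra! hlt
      obtain ⟨a, ha⟩ := h2 _ hlt
      exact ha (IsPurelyInseparable.exponent_def' F p a)

/-! ### Descent of Galois and purely inseparable maximal subfields -/

section Descent

variable {Z F D A : Type*} [Field Z] [Field F] [Algebra Z F] [DivisionRing D] [Algebra Z D]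
  [FiniteDimensional Z D] [DivisionRing A] [Algebra F A]

/-- With `B` stable under `Gal(K/F)`, the group acts on `L`. The action is faithful because some `σ
y - y` is made a unit of `K ∩ B` for each `σ ≠ 1`, and the dimension bound on `L` does the rest. -/
theorem exists_isGalois_of_baseChange (e : F ⊗[Z] D ≃ₐ[F] A)
    (hF : ∀ S : Finset F, Nonempty (Algebra.adjoin Z (S : Set F) →ₐ[Z] Z))
    (K : MaximalSubfield F A) [IsGalois F K] :
    ∃ L : MaximalSubfield Z D, IsGalois Z L ∧ Nonempty ((K ≃ₐ[F] K) ≃* (L ≃ₐ[Z] L)) := by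
  let _ : Algebra Z A := Algebra.compHom A (algebraMap Z F)
  have _ : IsScalarTower Z F A := IsScalarTower.of_algebraMap_eq fun _ => rfl
  have : FiniteDimensional F A := Module.Finite.equiv e.toLinearEquiv
  obtain ⟨g, hg⟩ := (Subalgebra.toSubmodule K.toSubalgebra).subtype.exists_leftInverse_of_injective
    (Submodule.ker_subtype _)
  have hg' : ∀ y : K, g y = y := fun y => LinearMap.congr_fun hg y
  let ext : (K ≃ₐ[F] K) → A →ₗ[F] A := fun σ =>
    K.toSubalgebra.val.toLinearMap ∘ₗ σ.toLinearMap ∘ₗ g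
  have hext : ∀ σ (y : K), ext σ y = (σ y : K) := fun σ y => by
    change ((σ (g y) : K) : A) = _
    rw [hg']
  have hne : ∀ σ : K ≃ₐ[F] K, ∃ y : K, σ ≠ 1 → σ y - y ≠ 0 := by
    intro σ
    by_contra! h
    obtain ⟨hσ, -⟩ := h 0
    exact hσ (AlgEquiv.ext fun y => sub_eq_zero.mp (h y).2)
  choose y hy using hne
  obtain ⟨B, ρ, h1, h2, h3, -, L, hL, hfin⟩ := exists_maximalSubfield_specialization e hF K
    (Set.range (fun σ => (y σ : A)) ∪ Set.range (fun σ => (((σ (y σ) - y σ)⁻¹ : K) : A)))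
    ((Set.finite_range _).union (Set.finite_range _)) (Set.range ext) (Set.finite_range _)
  rw [Set.union_subset_iff] at h1
  let T : Subalgebra Z B := (K.toSubalgebra.restrictScalars Z).comap B.val
  let p : T →ₐ[Z] L := (ρ.comp T.val).codRestrict L.toSubalgebra fun t => by
    rw [hL]; exact mem_specialize.mpr ⟨t, t.2, rfl⟩
  have hp : Function.Surjective p := by
    rintro ⟨x, hx⟩
    rw [hL] at hx
    obtain ⟨b, hb, rfl⟩ := mem_specialize.mp hx
    exact ⟨⟨b, hb⟩, rfl⟩
  let k : T → K := fun t => ⟨((t : B) : A), t.2⟩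
  have hk : Function.Injective k := fun t t' h =>
    Subtype.ext (Subtype.ext (congrArg (fun x : K => (x : A)) h))
  have hσB : ∀ (σ : K ≃ₐ[F] K) (t : T), ((σ (k t) : K) : A) ∈ B := fun σ t => by
    rw [← hext]; exact h2 _ ⟨σ, rfl⟩ _ t.1.2
  let f₀ : (K ≃ₐ[F] K) → T → T := fun σ t => ⟨⟨(σ (k t) : K), hσB σ t⟩, (σ (k t)).2⟩
  have hf₀ : ∀ σ t, k (f₀ σ t) = σ (k t) := fun σ t => rfl
  let f : (K ≃ₐ[F] K) →* (T →ₐ[Z] T) :=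
    { toFun := fun σ =>
        { toFun := f₀ σ
          map_one' := hk ((hf₀ _ _).trans (map_one σ))
          map_mul' := fun s t => hk ((hf₀ _ _).trans (map_mul σ (k s) (k t)))
          map_zero' := hk ((hf₀ _ _).trans (map_zero σ))
          map_add' := fun s t => hk ((hf₀ _ _).trans (map_add σ (k s) (k t)))
          commutes' := fun z => hk ((hf₀ _ _).trans (σ.commutes (algebraMap Z F z))) }
      map_one' := rfl
      map_mul' := fun _ _ => rfl }
  have hf : ∀ σ t, k (f σ t) = σ (k t) := fun σ t => rfl
  obtain ⟨θ, hθ⟩ := exists_autHom_of_surjective p hp f (by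
    intro σ t ht
    apply Subtype.ext
    exact h3 _ ⟨σ, rfl⟩ t (f σ t : T) (hext σ (k t)) (congrArg Subtype.val ht))
  have hinj : Function.Injective θ := by
    rw [injective_iff_map_eq_one]
    intro σ hσ
    by_contra hσ1
    have hyB : (y σ : A) ∈ B := h1.1 ⟨σ, rfl⟩
    have hiB : (((σ (y σ) - y σ)⁻¹ : K) : A) ∈ B := h1.2 ⟨σ, rfl⟩
    let t : T := ⟨⟨y σ, hyB⟩, (y σ).2⟩
    let u : T := ⟨⟨((σ (y σ) - y σ)⁻¹ : K), hiB⟩, ((σ (y σ) - y σ)⁻¹).2⟩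
    -- If `σ` acted trivially on `L`, the left side would specialise to `0`.
    have h4 : (f σ t - t) * u = 1 := hk (mul_inv_cancel₀ (hy σ hσ1))
    have h5 := hθ σ t
    rw [hσ, AlgEquiv.one_apply] at h5
    have h6 := congrArg p h4
    rw [map_mul, map_sub, ← h5, sub_self, zero_mul, map_one] at h6
    exact zero_ne_one h6
  obtain ⟨hG, hb⟩ := isGalois_and_bijective_of_injective hfin θ hinj
  exact ⟨L, hG, ⟨MulEquiv.ofBijective θ hb⟩⟩

theorem exists_isPurelyInseparableOfExponent_of_baseChange (e : F ⊗[Z] D ≃ₐ[F] A)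
    (hF : ∀ S : Finset F, Nonempty (Algebra.adjoin Z (S : Set F) →ₐ[Z] Z))
    (p : ℕ) [ExpChar Z p] (r : ℕ)
    (K : MaximalSubfield F A) (hK : IsPurelyInseparableOfExponent F K r) :
    ∃ L : MaximalSubfield Z D, IsPurelyInseparableOfExponent Z L r := by
  let _ : Algebra Z A := Algebra.compHom A (algebraMap Z F)
  have _ : IsScalarTower Z F A := IsScalarTower.of_algebraMap_eq fun _ => rfl
  have _ : ExpChar F p := expChar_of_injective_algebraMap (algebraMap Z F).injective p
  rw [isPurelyInseparableOfExponent_iff F K p] at hK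
  obtain ⟨hK1, hK2⟩ := hK
  -- For each `s < r`, the functional `μ` certifies linearly that `a ^ p ^ s` is not in `F`. After
  -- specialisation it excludes `ρ(a) ^ p ^ s = z` with `z` in `Z`, since it sends `a ^ p ^ s - z`
  -- to `1`.
  have hμ : ∀ s : Fin r, ∃ (a : K) (μ : A →ₗ[F] F), μ 1 = 0 ∧ μ ((a : A) ^ p ^ (s : ℕ)) = 1 := by
    intro s
    obtain ⟨a, ha⟩ := hK2 s s.2
    have h1 : (a : A) ^ p ^ (s : ℕ) ∉ Submodule.span F {(1 : A)} := by
      rw [Submodule.mem_span_singleton]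
      rintro ⟨c, hc⟩
      exact ha ⟨c, Subtype.ext (by rw [Algebra.smul_def, mul_one] at hc; exact hc)⟩
    obtain ⟨μ, hμ1, hμ2⟩ := Submodule.exists_le_ker_of_notMem h1
    refine ⟨a, (μ ((a : A) ^ p ^ (s : ℕ)))⁻¹ • μ, ?_, ?_⟩
    · have : μ 1 = 0 := hμ2 (Submodule.subset_span rfl)
      simp [this]
    · simp [inv_mul_cancel₀ hμ1]
  choose a μ hμ1 hμa using hμ
  obtain ⟨B, ρ, h1, h2, h3, h4, L, hL, -⟩ := exists_maximalSubfield_specialization e hF K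
    (Set.range fun s => (a s : A)) (Set.finite_range _)
    (Set.range fun s => Algebra.linearMap F A ∘ₗ μ s) (Set.finite_range _)
  refine ⟨L, (isPurelyInseparableOfExponent_iff Z L p r).mpr ⟨?_, ?_⟩⟩
  · rintro ⟨x, hx⟩
    rw [hL] at hx
    obtain ⟨b, hb, rfl⟩ := mem_specialize.mp hx
    obtain ⟨c, hc⟩ := hK1 ⟨b, hb⟩
    obtain ⟨z, hz⟩ := h4 c (b ^ p ^ r) (congrArg Subtype.val hc).symm
    refine ⟨z, Subtype.ext ?_⟩
    rw [map_pow] at hz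
    exact hz.symm
  · intro s hs
    let b : B := ⟨a ⟨s, hs⟩, h1 ⟨_, rfl⟩⟩
    refine ⟨⟨ρ b, by rw [hL]; exact mem_specialize.mpr ⟨b, (a ⟨s, hs⟩).2, rfl⟩⟩, ?_⟩
    rintro ⟨z, hz⟩
    have hz' : algebraMap Z D z = ρ b ^ p ^ s := congrArg Subtype.val hz
    have h5 : ρ (b ^ p ^ s - algebraMap Z B z) = 0 := by
      rw [map_sub, map_pow, AlgHom.commutes, hz', sub_self]
    have h6 := h3 _ ⟨⟨s, hs⟩, rfl⟩ (b ^ p ^ s - algebraMap Z B z) 1 (by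
      have h7 : ((b ^ p ^ s - algebraMap Z B z : B) : A) =
          (a ⟨s, hs⟩ : A) ^ p ^ s - algebraMap Z F z • (1 : A) := by
        rw [Algebra.smul_def, mul_one]; rfl
      rw [h7]
      simp [hμ1, hμa ⟨s, hs⟩]) h5
    rw [map_one] at h6
    exact one_ne_zero h6

end Descent


/-! ### Ascent of maximal subfields by scalar extension -/

section Ascent

variable {Z F D A : Type*} [Field Z] [Field F] [Algebra Z F] [DivisionRing D] [Algebra Z D]
  [DivisionRing A] [Algebra F A]

/-- Extension of scalars takes maximal subfields to maximal subfields. -/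
theorem exists_maximalSubfield_baseChange (e : F ⊗[Z] D ≃ₐ[F] A) (L : MaximalSubfield Z D) :
    ∃ K : MaximalSubfield F A, Nonempty (F ⊗[Z] L ≃ₐ[F] K) := by
  let m : F ⊗[Z] L →ₐ[F] F ⊗[Z] D := Algebra.TensorProduct.map (AlgHom.id F F) L.toSubalgebra.val
  let f : F ⊗[Z] L →ₐ[F] A := e.toAlgHom.comp m
  have hf : Function.Injective f := e.injective.comp
    (Module.Flat.lTensor_preserves_injective_linearMap (M := F)
      L.toSubalgebra.val.toLinearMap Subtype.val_injective)
  have hc := Subalgebra.centralizer_coe_map_includeRight_eq_center_tensorProduct Z F D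
    L.toSubalgebra
  -- Forming centralizers commutes with scalar extension, so the centralizer of `1 ⊗ L` is `F ⊗ L`.
  have hm : ∀ t, t ∈ m.range ↔ t ∈ Subalgebra.centralizer Z (L.toSubalgebra.map
      (Algebra.TensorProduct.includeRight (R := Z) (A := F)) : Set (F ⊗[Z] D)) := by
    rw [hc, L.centralizer_eq]
    exact fun t => Iff.rfl
  refine ⟨⟨f.range, ?_⟩, ⟨AlgEquiv.ofInjective f hf⟩⟩
  ext x
  obtain ⟨t, rfl⟩ := e.surjective x
  have ht : e t ∈ f.range ↔ t ∈ m.range := by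
    constructor
    · rintro ⟨u, hu⟩
      exact ⟨u, e.injective hu⟩
    · rintro ⟨u, rfl⟩
      exact ⟨u, rfl⟩
  rw [ht]
  constructor
  · intro h
    rw [hm, Subalgebra.mem_centralizer_iff]
    rintro _ ⟨l, hl, rfl⟩
    apply e.injective
    rw [map_mul, map_mul]
    exact (Subalgebra.mem_centralizer_iff F).mp h _ ⟨1 ⊗ₜ ⟨l, hl⟩, rfl⟩
  · intro h
    rw [Subalgebra.mem_centralizer_iff]
    rintro _ ⟨u, rfl⟩
    obtain ⟨v, rfl⟩ := h
    change f u * f v = f v * f u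
    have : u * v = v * u := mul_comm (G := F ⊗[Z] L) u v
    rw [← map_mul, ← map_mul, this]

/-- The group `Aut L` acts faithfully on `F ⊗ L` through the second factor. The counting lemma
applies since the degree is unchanged. -/
theorem exists_isGalois_baseChange [FiniteDimensional Z D] (e : F ⊗[Z] D ≃ₐ[F] A)
    (L : MaximalSubfield Z D) [IsGalois Z L] :
    ∃ K : MaximalSubfield F A, IsGalois F K ∧ Nonempty ((K ≃ₐ[F] K) ≃* (L ≃ₐ[Z] L)) := by
  obtain ⟨K, ⟨ε⟩⟩ := exists_maximalSubfield_baseChange e L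
  have : FiniteDimensional F K := Module.Finite.equiv ε.toLinearEquiv
  have hfin : Module.finrank F K = Module.finrank Z L := by
    rw [← ε.toLinearEquiv.finrank_eq, Module.finrank_baseChange]
  let θ : (L ≃ₐ[Z] L) →* (K ≃ₐ[F] K) :=
    { toFun := fun σ => ε.symm.trans ((Algebra.TensorProduct.congr AlgEquiv.refl σ).trans ε)
      map_one' := by
        ext x
        change ((ε (Algebra.TensorProduct.map (AlgHom.id F F) (AlgHom.id Z L) (ε.symm x)) : K) : A)
          = x
        rw [Algebra.TensorProduct.map_id]
        simp
      map_mul' := fun σ τ => by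
        ext x
        obtain ⟨t, rfl⟩ := ε.surjective x
        simp only [AlgEquiv.mul_apply, AlgEquiv.trans_apply, AlgEquiv.symm_apply_apply]
        congr 2
        induction t using TensorProduct.induction_on with
        | zero => simp
        | tmul c l => simp
        | add x y hx hy => rw [map_add, map_add, map_add, hx, hy] }
  have hθ : ∀ σ l, θ σ (ε (1 ⊗ₜ l)) = ε (1 ⊗ₜ σ l) := fun σ l => by simp [θ]
  have hinj : Function.Injective θ := by
    intro σ τ h
    ext l
    have h1 : ε (1 ⊗ₜ σ l) = ε (1 ⊗ₜ τ l) := by rw [← hθ, ← hθ, h]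
    exact congrArg Subtype.val (Algebra.TensorProduct.includeRight_injective (R := Z) (A := F)
      (algebraMap Z F).injective (ε.injective h1))
  obtain ⟨hG, hb⟩ := isGalois_and_bijective_of_injective hfin.le θ hinj
  exact ⟨K, hG, ⟨(MulEquiv.ofBijective θ hb).symm⟩⟩

theorem exists_isPurelyInseparableOfExponent_baseChange (e : F ⊗[Z] D ≃ₐ[F] A)
    (p : ℕ) [ExpChar Z p] (r : ℕ) (L : MaximalSubfield Z D)
    (hL : IsPurelyInseparableOfExponent Z L r) :
    ∃ K : MaximalSubfield F A, IsPurelyInseparableOfExponent F K r := by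
  have _ : ExpChar F p := expChar_of_injective_algebraMap (algebraMap Z F).injective p
  obtain ⟨K, ⟨ε⟩⟩ := exists_maximalSubfield_baseChange e L
  have _ : ExpChar K p := expChar_of_injective_algebraMap (algebraMap F K).injective p
  have _ : ExpChar (F ⊗[Z] L) p :=
    have := ε.toEquiv.nontrivial
    expChar_of_injective_algebraMap (algebraMap F (F ⊗[Z] L)).injective p
  rw [isPurelyInseparableOfExponent_iff Z L p] at hL
  refine ⟨K, (isPurelyInseparableOfExponent_iff F K p r).mpr ⟨fun x => ?_, fun s hs => ?_⟩⟩
  · obtain ⟨t, rfl⟩ := ε.surjective x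
    suffices h : ∃ c : F, t ^ p ^ r = algebraMap F (F ⊗[Z] L) c by
      obtain ⟨c, hc⟩ := h
      exact ⟨c, by rw [← map_pow, hc, ε.commutes]⟩
    induction t using TensorProduct.induction_on with
    | zero => exact ⟨0, by rw [map_zero, zero_pow (pow_pos (expChar_pos Z p) r).ne']⟩
    | tmul c l =>
      obtain ⟨z, hz⟩ := hL.1 l
      refine ⟨c ^ p ^ r * algebraMap Z F z, ?_⟩
      rw [Algebra.TensorProduct.tmul_pow, ← hz, Algebra.TensorProduct.algebraMap_apply,
        Algebra.algebraMap_eq_smul_one z, ← TensorProduct.smul_tmul, Algebra.smul_def, mul_comm]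
      rfl
    | add x y hx hy =>
      obtain ⟨c, hc⟩ := hx
      obtain ⟨c', hc'⟩ := hy
      exact ⟨c + c', by rw [add_pow_expChar_pow, hc, hc', map_add]⟩
  · obtain ⟨a, ha⟩ := hL.2 s hs
    refine ⟨ε (1 ⊗ₜ a), ?_⟩
    rintro ⟨c, hc⟩
    rw [← map_pow, ← ε.commutes, ε.injective.eq_iff, Algebra.TensorProduct.tmul_pow, one_pow] at hc
    -- A functional that kills `1` but not `a ^ p ^ s` contradicts `1 ⊗ a ^ p ^ s = c ⊗ 1`.
    have h1 : a ^ p ^ s ∉ Submodule.span Z {(1 : L)} := by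
      rw [Submodule.mem_span_singleton]
      rintro ⟨z, hz⟩
      exact ha ⟨z, by rw [← hz, Algebra.smul_def, mul_one]⟩
    obtain ⟨μ, hμ1, hμ2⟩ := Submodule.exists_le_ker_of_notMem h1
    have hμ : μ 1 = 0 := hμ2 (Submodule.subset_span rfl)
    have h2 := congrArg (fun t => TensorProduct.rid Z F (μ.lTensor F t)) hc
    simp [Algebra.TensorProduct.algebraMap_apply, hμ] at h2
    exact hμ1 (by simpa using h2.symm)

end Ascent

/-! ### Splitting and the Brauer exponent under scalar extension -/

section Split

variable {Z F E A : Type*} [Field Z] [Field F] [Algebra Z F] [Ring E] [Algebra Z E]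
  [Ring A] [Algebra F A]

/-- The algebra `E` is split if its scalar extension to `F` is. -/
theorem nonempty_algEquiv_matrix_of_baseChange [FiniteDimensional Z E] (e : F ⊗[Z] E ≃ₐ[F] A)
    (hF : ∀ S : Finset F, Nonempty (Algebra.adjoin Z (S : Set F) →ₐ[Z] Z)) {N : ℕ} (hN : 1 ≤ N)
    (h : A ≃ₐ[F] Matrix (Fin N) (Fin N) F) : Nonempty (E ≃ₐ[Z] Matrix (Fin N) (Fin N) Z) := by
  let _ : Algebra Z A := Algebra.compHom A (algebraMap Z F)
  have _ : IsScalarTower Z F A := IsScalarTower.of_algebraMap_eq fun _ => rfl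
  have : NeZero N := ⟨by omega⟩
  have hfin : Module.finrank Z E = N * N := by
    rw [← Module.finrank_baseChange (R := F), (e.trans h).toLinearEquiv.finrank_eq]
    simp [Module.finrank_matrix]
  have : Nontrivial E := Module.nontrivial_of_finrank_pos (R := Z) (by
    rw [hfin]; exact Nat.mul_pos hN hN)
  -- The matrix units of `A` span a copy of `M_N(Z)`. Placed inside `B`, it maps to `E`, injectively
  -- because `M_N(Z)` is simple, and onto by dimension.
  let i : Matrix (Fin N) (Fin N) Z →ₐ[Z] A :=
    (h.symm.restrictScalars Z).toAlgHom.comp (Algebra.ofId Z F).mapMatrix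
  obtain ⟨B, ρ, -, h1, -⟩ := exists_specialization e hF
    (Set.range fun jk : Fin N × Fin N => i (Matrix.single jk.1 jk.2 1)) (Set.finite_range _) ∅
    Set.finite_empty
  have hi : ∀ M, i M ∈ B := by
    intro M
    rw [Matrix.matrix_eq_sum_single M, map_sum]
    refine sum_mem fun j _ => ?_
    rw [map_sum]
    refine sum_mem fun k _ => ?_
    have : Matrix.single j k (M j k) = M j k • Matrix.single j k (1 : Z) := by simp
    rw [this, map_smul]
    exact B.smul_mem (h1 ⟨(j, k), rfl⟩) _
  let f : Matrix (Fin N) (Fin N) Z →ₐ[Z] E := ρ.comp (i.codRestrict B hi)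
  have hf : Function.Injective f := (f : Matrix (Fin N) (Fin N) Z →+* E).injective
  have hf' : Function.Bijective f := ⟨hf,
    (LinearMap.injective_iff_surjective_of_finrank_eq_finrank (f := f.toLinearMap) (by
      rw [hfin]; simp [Module.finrank_matrix])).mp hf⟩
  exact ⟨(AlgEquiv.ofBijective f hf').symm⟩

theorem nonempty_algEquiv_matrix_baseChange (e : F ⊗[Z] E ≃ₐ[F] A) {N : ℕ}
    (h : E ≃ₐ[Z] Matrix (Fin N) (Fin N) Z) : Nonempty (A ≃ₐ[F] Matrix (Fin N) (Fin N) F) :=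
  ⟨e.symm.trans ((Algebra.TensorProduct.congr AlgEquiv.refl h).trans
    (AlgEquiv.ofRingEquiv (f := (matrixEquivTensor (Fin N) Z F).symm.toRingEquiv) fun c => by
      simpa [Algebra.TensorProduct.algebraMap_apply] using
        (Algebra.algebraMap_eq_smul_one c).symm))⟩

/-- Tensor powers commute with extension of scalars. -/
theorem nonempty_baseChange_piTensorProduct [FiniteDimensional Z E] (e : F ⊗[Z] E ≃ₐ[F] A)
    (n : ℕ) : Nonempty (F ⊗[Z] (⨂[Z] _ : Fin n, E) ≃ₐ[F] (⨂[F] _ : Fin n, A)) := by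
  let _ : Algebra Z A := Algebra.compHom A (algebraMap Z F)
  have _ : IsScalarTower Z F A := IsScalarTower.of_algebraMap_eq fun _ => rfl
  have : FiniteDimensional F A := Module.Finite.equiv e.toLinearEquiv
  let i : E →ₐ[Z] A := (e.restrictScalars Z).toAlgHom.comp Algebra.TensorProduct.includeRight
  let g : (⨂[Z] _ : Fin n, E) →ₐ[Z] (⨂[F] _ : Fin n, A) :=
    PiTensorProduct.liftAlgHom
      (((PiTensorProduct.tprod F).restrictScalars Z).compLinearMap fun _ => i.toLinearMap)
      (by
        change PiTensorProduct.tprod F (fun _ => i 1) = 1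
        simp only [map_one]
        rfl)
      (fun x y => by
        change PiTensorProduct.tprod F (fun j => i (x j * y j)) =
          PiTensorProduct.tprod F (fun j => i (x j)) * PiTensorProduct.tprod F (fun j => i (y j))
        simp only [map_mul, PiTensorProduct.tprod_mul_tprod]
        rfl)
  have hg : ∀ x, g (PiTensorProduct.tprod Z x) = PiTensorProduct.tprod F fun j => i (x j) :=
    fun x => PiTensorProduct.lift.tprod x
  let f : F ⊗[Z] (⨂[Z] _ : Fin n, E) →ₐ[F] (⨂[F] _ : Fin n, A) :=
    Algebra.TensorProduct.lift (Algebra.ofId _ _) g fun c _ => Algebra.commutes c _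
  have hf1 : ∀ t, f (1 ⊗ₜ t) = g t := fun t =>
    (Algebra.TensorProduct.lift_tmul _ _ _ _ _).trans (by rw [map_one, one_mul])
  let b := Module.finBasis Z E
  let b' := (b.baseChange F).map e.toLinearEquiv
  have hb' : ∀ k, b' k = i (b k) := fun k => by simp [b', i]
  let c := Basis.piTensorProduct fun _ : Fin n => b
  let c' := Basis.piTensorProduct fun _ : Fin n => b'
  -- Bijectivity: `f` carries the basis of pure tensors to the corresponding basis.
  have hf : f.toLinearMap = ((c.baseChange F).equiv c' (Equiv.refl _)).toLinearMap := by
    refine (c.baseChange F).ext fun k => ?_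
    have h1 : f (c.baseChange F k) = c' k := by
      rw [Module.Basis.baseChange_apply, Basis.piTensorProduct_apply, Basis.piTensorProduct_apply]
      rw [hf1, hg]
      simp only [hb']
    rw [AlgHom.toLinearMap_apply, h1, LinearEquiv.coe_coe, Module.Basis.equiv_apply]
    rfl
  refine ⟨AlgEquiv.ofBijective f ?_⟩
  have h2 : (f : F ⊗[Z] (⨂[Z] _ : Fin n, E) → (⨂[F] _ : Fin n, A)) =
      (c.baseChange F).equiv c' (Equiv.refl _) := funext fun x => LinearMap.congr_fun hf x
  rw [h2]
  exact LinearEquiv.bijective _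

/-- For every `n`, the `n`-th tensor powers of `E` and `A` are split by matrix algebras of the same
size `N`, so the two infima are over the same set. -/
theorem brauerExponent_baseChange [FiniteDimensional Z E] (e : F ⊗[Z] E ≃ₐ[F] A)
    (hF : ∀ S : Finset F, Nonempty (Algebra.adjoin Z (S : Set F) →ₐ[Z] Z)) :
    brauerExponent F A = brauerExponent Z E := by
  unfold brauerExponent
  congr 1
  ext n
  obtain ⟨e'⟩ := nonempty_baseChange_piTensorProduct e n
  refine and_congr_right fun _ => exists_congr fun N => and_congr_right fun hN => ⟨?_, ?_⟩
  · rintro ⟨h⟩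
    exact nonempty_algEquiv_matrix_of_baseChange e' hF hN h
  · rintro ⟨h⟩
    exact nonempty_algEquiv_matrix_baseChange e' h

end Split


/-! ### One-dimensional algebras, for the case of finite `Z` -/

section Trivial

theorem isGalois_of_finrank_eq_one {Z L : Type*} [Field Z] [Field L] [Algebra Z L]
    (h : Module.finrank Z L = 1) : IsGalois Z L ∧ Subsingleton (L ≃ₐ[Z] L) := by
  have : FiniteDimensional Z L := Module.finite_of_finrank_pos (by omega)
  have h1 : Nat.card (L ≃ₐ[Z] L) ≤ 1 := by
    rw [← h, Nat.card_eq_fintype_card]; exact AlgEquiv.card_le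
  have h2 : Subsingleton (L ≃ₐ[Z] L) := Finite.card_le_one_iff_subsingleton.mp h1
  exact ⟨IsGalois.of_card_aut_eq_finrank _ _ (by rw [h]; exact Nat.card_unique), h2⟩

theorem bijective_ofId_of_finrank_eq_one {Z B : Type*} [Field Z] [Ring B] [Algebra Z B]
    (h : Module.finrank Z B = 1) : Function.Bijective (Algebra.ofId Z B) := by
  have : Nontrivial B := Module.nontrivial_of_finrank_pos (R := Z) (by omega)
  refine ⟨(algebraMap Z B).injective, fun b => ?_⟩
  have : b ∈ (⊥ : Subalgebra Z B) := by
    rw [Subalgebra.bot_eq_top_of_finrank_eq_one h]; trivial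
  exact this

theorem isPurelyInseparableOfExponent_iff_eq_zero {Z L : Type*} [Field Z] [Field L] [Algebra Z L]
    (h : Module.finrank Z L = 1) (r : ℕ) : IsPurelyInseparableOfExponent Z L r ↔ r = 0 := by
  have hs : ∀ a : L, a ∈ (algebraMap Z L).range :=
    (bijective_ofId_of_finrank_eq_one h).2
  obtain ⟨p, _⟩ := ExpChar.exists Z
  rw [isPurelyInseparableOfExponent_iff Z L p]
  constructor
  · rintro ⟨-, h2⟩
    by_contra hr
    obtain ⟨a, ha⟩ := h2 0 (Nat.pos_of_ne_zero hr)
    exact ha (hs _)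
  · rintro rfl
    exact ⟨fun a => hs _, fun s hs => absurd hs (Nat.not_lt_zero s)⟩

theorem MaximalSubfield.finrank_eq_one {F A : Type*} [Field F] [DivisionRing A] [Algebra F A]
    (h : Module.finrank F A = 1) (K : MaximalSubfield F A) : Module.finrank F K = 1 := by
  have : FiniteDimensional F A := Module.finite_of_finrank_pos (by omega)
  have h1 : Module.finrank F K ≤ Module.finrank F A :=
    Submodule.finrank_le (Subalgebra.toSubmodule K.toSubalgebra)
  have h2 : 0 < Module.finrank F K := Module.finrank_pos
  omega

theorem nonempty_maximalSubfield_of_finrank_eq_one {F A : Type*} [Field F] [DivisionRing A]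
    [Algebra F A] (h : Module.finrank F A = 1) : Nonempty (MaximalSubfield F A) :=
  ⟨⟨⊤, le_antisymm le_top (by
    rw [← Subalgebra.bot_eq_top_of_finrank_eq_one h]; exact bot_le)⟩⟩

theorem nonempty_piTensorProduct_algEquiv_matrix {Z D : Type*} [Field Z] [Ring D] [Algebra Z D]
    (h : Module.finrank Z D = 1) (n : ℕ) :
    Nonempty ((⨂[Z] _ : Fin n, D) ≃ₐ[Z] Matrix (Fin 1) (Fin 1) Z) := by
  have : FiniteDimensional Z D := Module.finite_of_finrank_pos (by omega)
  have h1 : Module.finrank Z (⨂[Z] _ : Fin n, D) = 1 := by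
    rw [Module.finrank_eq_card_basis (Basis.piTensorProduct fun _ : Fin n => Module.finBasis Z D)]
    simp [h]
  have h2 : Module.finrank Z (Matrix (Fin 1) (Fin 1) Z) = 1 := by simp [Module.finrank_matrix]
  exact ⟨(AlgEquiv.ofBijective _ (bijective_ofId_of_finrank_eq_one h1)).symm.trans
    (AlgEquiv.ofBijective _ (bijective_ofId_of_finrank_eq_one h2))⟩

end Trivial

/-! ### Descent from `D(X)`, with finite and infinite `Z` treated separately -/

section Rational

variable {Z D : Type*} [Field Z] [DivisionRing D] [Algebra Z D] [Algebra.IsCentral Z D]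
  [FiniteDimensional Z D] {q : ℕ}

theorem brauerExponent_skewRatFunc :
    brauerExponent (RatFuncField Z q) (SkewRatFunc Z D q) = brauerExponent Z D := by
  rcases finite_or_infinite Z with hZ | hZ
  · have h := finrank_eq_one_of_finite Z D
    have h' := (finrank_skewRatFunc Z D q).trans h
    unfold brauerExponent
    congr 1
    ext n
    exact and_congr_right fun _ => iff_of_true
      ⟨1, le_rfl, nonempty_piTensorProduct_algEquiv_matrix h' n⟩
      ⟨1, le_rfl, nonempty_piTensorProduct_algEquiv_matrix h n⟩
  · exact brauerExponent_baseChange (baseChangeEquiv Z D q) nonempty_adjoin_algHom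

theorem exists_isGalois_of_skewRatFunc
    (K : MaximalSubfield (RatFuncField Z q) (SkewRatFunc Z D q)) [IsGalois (RatFuncField Z q) K] :
    ∃ L : MaximalSubfield Z D, IsGalois Z L ∧
      Nonempty ((K ≃ₐ[RatFuncField Z q] K) ≃* (L ≃ₐ[Z] L)) := by
  rcases finite_or_infinite Z with hZ | hZ
  · have h := finrank_eq_one_of_finite Z D
    obtain ⟨L⟩ := nonempty_maximalSubfield_of_finrank_eq_one h
    have h1 := isGalois_of_finrank_eq_one (L.finrank_eq_one h)
    have h2 := h1.2
    have h3 := (isGalois_of_finrank_eq_one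
      (K.finrank_eq_one ((finrank_skewRatFunc Z D q).trans h))).2
    -- For finite `Z` both fields have degree one, so both groups are trivial.
    let _ := Unique.mk' (K ≃ₐ[RatFuncField Z q] K)
    let _ := Unique.mk' (L ≃ₐ[Z] L)
    exact ⟨L, h1.1, ⟨MulEquiv.ofUnique⟩⟩
  · exact exists_isGalois_of_baseChange (baseChangeEquiv Z D q) nonempty_adjoin_algHom K

theorem exists_isPurelyInseparableOfExponent_of_skewRatFunc (p : ℕ) [ExpChar Z p] (r : ℕ)
    (K : MaximalSubfield (RatFuncField Z q) (SkewRatFunc Z D q))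
    (hK : IsPurelyInseparableOfExponent (RatFuncField Z q) K r) :
    ∃ L : MaximalSubfield Z D, IsPurelyInseparableOfExponent Z L r := by
  rcases finite_or_infinite Z with hZ | hZ
  · have h := finrank_eq_one_of_finite Z D
    obtain ⟨L⟩ := nonempty_maximalSubfield_of_finrank_eq_one h
    rw [isPurelyInseparableOfExponent_iff_eq_zero
      (K.finrank_eq_one ((finrank_skewRatFunc Z D q).trans h))] at hK
    exact ⟨L, (isPurelyInseparableOfExponent_iff_eq_zero (L.finrank_eq_one h) r).mpr hK⟩
  · exact exists_isPurelyInseparableOfExponent_of_baseChange (baseChangeEquiv Z D q)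
      nonempty_adjoin_algHom p r K hK

end Rational

end SkewRational

theorem theorem1p2p5 {Z D : Type*} [Field Z] [DivisionRing D] [Algebra Z D]
    [Algebra.IsCentral Z D] [FiniteDimensional Z D] (q : ℕ) :
    -- (1) dimensions over the centres, and exponents
    (Module.finrank (SkewRational.RatFuncField Z q) (SkewRational.SkewRatFunc Z D q) =
        Module.finrank Z D ∧
      SkewRational.brauerExponent (SkewRational.RatFuncField Z q) (SkewRational.SkewRatFunc Z D q) =
        SkewRational.brauerExponent Z D) ∧
    -- (2) maximal subfields that are Galois over the centre
    ((∃ K : SkewRational.MaximalSubfield (SkewRational.RatFuncField Z q)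
          (SkewRational.SkewRatFunc Z D q), IsGalois (SkewRational.RatFuncField Z q) K) ↔
      ∃ K : SkewRational.MaximalSubfield Z D, IsGalois Z K) ∧
    -- (3) characteristic `p`: purely inseparable of exponent `r`; Galois with group `(ℤ/p)^r`
    (∀ p : ℕ, p.Prime → CharP Z p → ∀ r : ℕ,
      ((∃ K : SkewRational.MaximalSubfield (SkewRational.RatFuncField Z q)
            (SkewRational.SkewRatFunc Z D q),
          SkewRational.IsPurelyInseparableOfExponent (SkewRational.RatFuncField Z q) K r) ↔
        ∃ K : SkewRational.MaximalSubfield Z D,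
          SkewRational.IsPurelyInseparableOfExponent Z K r) ∧
      ((∃ K : SkewRational.MaximalSubfield (SkewRational.RatFuncField Z q)
            (SkewRational.SkewRatFunc Z D q),
          IsGalois (SkewRational.RatFuncField Z q) K ∧
            Nonempty ((K ≃ₐ[SkewRational.RatFuncField Z q] K) ≃*
              Multiplicative (Fin r → ZMod p))) ↔
        ∃ K : SkewRational.MaximalSubfield Z D,
          IsGalois Z K ∧ Nonempty ((K ≃ₐ[Z] K) ≃* Multiplicative (Fin r → ZMod p)))) := by

  open SkewRational in
  refine ⟨⟨finrank_skewRatFunc Z D q, brauerExponent_skewRatFunc⟩, ⟨?_, ?_⟩,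
    fun p hp hc r => ⟨⟨?_, ?_⟩, ⟨?_, ?_⟩⟩⟩
  · rintro ⟨K, hK⟩
    obtain ⟨L, hL, -⟩ := exists_isGalois_of_skewRatFunc K
    exact ⟨L, hL⟩
  · rintro ⟨L, hL⟩
    obtain ⟨K, hK, -⟩ := exists_isGalois_baseChange (baseChangeEquiv Z D q) L
    exact ⟨K, hK⟩
  · rintro ⟨K, hK⟩
    have : ExpChar Z p := ExpChar.prime hp
    exact exists_isPurelyInseparableOfExponent_of_skewRatFunc p r K hK
  · rintro ⟨L, hL⟩
    have : ExpChar Z p := ExpChar.prime hp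
    exact exists_isPurelyInseparableOfExponent_baseChange (baseChangeEquiv Z D q) p r L hL
  · rintro ⟨K, hK, ⟨g⟩⟩
    obtain ⟨L, hL, ⟨g'⟩⟩ := exists_isGalois_of_skewRatFunc K
    exact ⟨L, hL, ⟨g'.symm.trans g⟩⟩
  · rintro ⟨L, hL, ⟨g⟩⟩
    obtain ⟨K, hK, ⟨g'⟩⟩ := exists_isGalois_baseChange (baseChangeEquiv Z D q) L
    exact ⟨K, hK, ⟨g'.trans g⟩⟩
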